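/- For finite simple graphs $H_1$ and $H_2$, let the Ramsey number $r(H_1,H_2)$ be the smallest positive integer $N$ such that every simple graph $F$ on $N$ vertices contains $H_1$ as a (not necessarily induced) subgraph, or its complement $\overline{F}$ contains $H_2$ as a subgraph; let $C_k$ be the cycle with $k$ vertices. For any integers $k\ge 3$ and $n\ge 12k$, if $G$ is a connected simple graph with $n$ vertices and at most $\left(1+\frac{1}{12k^2}\right)n$ edges, then $r(G,C_k)\le 2n+23k^2$. -/

import Mathlib

/-- Every graph on `N` vertices contains `G` as a (not necessarily induced) subgraph, or its
complement contains `H` as a subgraph. -/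
def RamseyArrows {V W : Type*} (G : SimpleGraph V) (H : SimpleGraph W) (N : ℕ) : Prop :=
  ∀ F : SimpleGraph (Fin N), G.IsContained F ∨ H.IsContained Fᶜ

/-- The Ramsey number `r(G, H)`: the smallest positive integer `N` such that every graph on `N`
vertices contains `G`, or its complement contains `H`. -/
noncomputable def ramseyNumber {V W : Type*} (G : SimpleGraph V) (H : SimpleGraph W) : ℕ :=
  sInf {N : ℕ | 0 < N ∧ RamseyArrows G H N}

open Finset

/-! Put `l = ⌊n / (12k²)⌋`. Then `G` has at most `n + l` edges and, being connected, spans at most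
`|S| + l` edges on every nonempty vertex set `S`. Let `F` have `2n + 23k²` vertices and a `C_k`-free
complement. Neighbourhoods in `Fᶜ` are `(k - 3)`-degenerate (`degenerateOn_of_cycle_free`), so each
contains a clique of `F` on at least a `1 / (k - 2)` fraction of its vertices. The maximum degree
`Δ` of `Fᶜ` decides how `G` is embedded.

If `Δ ≥ n + 23k²`, `G` fits into one neighbourhood (`exists_isEmb_of_large_nbhd`): the few vertices
of large co-degree are avoided, except by an independent set of low-degree vertices of `G` placed
last. Otherwise leaves can be appended greedily, and it remains to embed a connected core of minimum
degree two (`exists_isEmb_of_core`).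

If `Δ ≤ (k - 2)(16l + 5k)`, the core vertices of high degree go into a clique and the others are
placed greedily. If not, `F` has a clique `Q` on `16l + 5k` vertices. When `n` outside vertices have
few `F`-neighbours in `Q`, they pairwise share many `Fᶜ`-neighbours and hence form a clique of `F`
(`not_adj_of_common_neighbours`). Otherwise the remaining vertices are covered by at most `k - 1`
paths of `F`. The core is a linear forest apart from `8l + 3` vertices; the forest follows the paths
and `Q` absorbs the rest (`exists_isEmb_of_listing`). -/

namespace SparseRamsey

variable {α V W : Type*}

/-! ### Degree sums, degeneracy and connectivity on finite vertex sets. -/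

open Classical in
/-- The neighbours of `v` inside the finite set `S`. -/
noncomputable def nbIn (H : SimpleGraph α) (v : α) (S : Finset α) : Finset α :=
  S.filter fun u => H.Adj v u

@[simp] lemma mem_nbIn {H : SimpleGraph α} {v u : α} {S : Finset α} :
    u ∈ nbIn H v S ↔ u ∈ S ∧ H.Adj v u := by
  classical
  simp [nbIn]

lemma nbIn_subset (H : SimpleGraph α) (v : α) (S : Finset α) : nbIn H v S ⊆ S :=
  fun _ hu => (mem_nbIn.1 hu).1

lemma nbIn_mono (H : SimpleGraph α) (v : α) {S T : Finset α} (h : S ⊆ T) :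
    nbIn H v S ⊆ nbIn H v T := fun u hu => by
  rw [mem_nbIn] at hu ⊢
  exact ⟨h hu.1, hu.2⟩

/-- Every nonempty subset of `S` has a vertex with at most `d` neighbours in that subset. -/
def DegenerateOn (H : SimpleGraph α) (S : Finset α) (d : ℕ) : Prop :=
  ∀ T ⊆ S, T.Nonempty → ∃ v ∈ T, #(nbIn H v T) ≤ d

lemma DegenerateOn.subset {H : SimpleGraph α} {S T : Finset α} {d : ℕ}
    (h : DegenerateOn H S d) (hT : T ⊆ S) : DegenerateOn H T d :=
  fun U hU hne => h U (hU.trans hT) hne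

/-- Every proper nonempty part of `S` is joined by an edge to the rest of `S`. -/
def CutConnected (H : SimpleGraph α) (S : Finset α) : Prop :=
  ∀ T ⊂ S, T.Nonempty → ∃ u ∈ T, ∃ v ∈ S, v ∉ T ∧ H.Adj u v

lemma sum_nbIn_insert [DecidableEq α] (H : SimpleGraph α) {S : Finset α} {v : α} (hv : v ∉ S) :
    ∑ x ∈ insert v S, #(nbIn H x (insert v S)) = ∑ x ∈ S, #(nbIn H x S) + 2 * #(nbIn H v S) := by
  classical
  have h1 : nbIn H v (insert v S) = nbIn H v S := by
    ext u
    simp only [mem_nbIn, mem_insert]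
    constructor
    · rintro ⟨rfl | h, h'⟩
      · exact absurd h' (H.irrefl)
      · exact ⟨h, h'⟩
    · rintro ⟨h, h'⟩
      exact ⟨Or.inr h, h'⟩
  have h2 : ∀ x ∈ S, #(nbIn H x (insert v S)) = #(nbIn H x S) + if H.Adj v x then 1 else 0 := by
    intro x _
    simp only [nbIn, filter_insert]
    by_cases h : H.Adj v x
    · rw [if_pos h.symm, if_pos h, card_insert_of_notMem]
      simp [hv]
    · rw [if_neg (fun h' => h h'.symm), if_neg h, add_zero]
  rw [sum_insert hv, h1, sum_congr rfl h2, sum_add_distrib, sum_boole]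
  simp only [nbIn, Nat.cast_id]
  ring

/-- In a connected graph, adding the vertices outside `S` one at a time adds an edge each time. -/
lemma CutConnected.sum_nbIn_le {H : SimpleGraph α} {C : Finset α} (hC : CutConnected H C) :
    ∀ S ⊆ C, S.Nonempty →
      ∑ x ∈ S, #(nbIn H x S) + 2 * #C ≤ ∑ x ∈ C, #(nbIn H x C) + 2 * #S := by
  classical
  intro S hS hne
  induction hm : #C - #S generalizing S with
  | zero =>
    have : S = C := eq_of_subset_of_card_le hS (by omega)
    subst this
    exact le_rfl
  | succ m ih =>
    have hss : S ⊂ C := by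
      refine Finset.ssubset_iff_subset_ne.2 ⟨hS, ?_⟩
      rintro rfl
      omega
    obtain ⟨u, hu, v, hv, hvS, huv⟩ := hC S hss hne
    have hcard := card_insert_of_notMem hvS
    have := ih (insert v S) (insert_subset hv hS) (insert_nonempty _ _) (by omega)
    rw [sum_nbIn_insert H hvS] at this
    have hpos : 0 < #(nbIn H v S) := card_pos.2 ⟨u, by simp [hu, huv.symm]⟩
    omega

lemma cutConnected_univ [Fintype V] {G : SimpleGraph V} (hG : G.Connected) :
    CutConnected G univ := by
  intro T hT ⟨a, ha⟩
  obtain ⟨b, -, hb⟩ := exists_of_ssubset hT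
  obtain ⟨p⟩ := hG.preconnected a b
  obtain ⟨d, -, h1, h2⟩ := p.exists_boundary_dart (T : Set V) ha hb
  exact ⟨d.fst, h1, d.snd, mem_univ _, h2, d.adj⟩

lemma sum_nbIn_univ [Fintype V] (G : SimpleGraph V) :
    ∑ x : V, #(nbIn G x univ) = 2 * G.edgeSet.ncard := by
  classical
  rw [← SimpleGraph.coe_edgeFinset, Set.ncard_coe_finset, ← G.sum_degrees_eq_twice_card_edges]
  refine sum_congr rfl fun x _ => ?_
  rw [← G.card_neighborFinset_eq_degree]
  congr 1
  ext u
  simp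

/-- An edge leaving `T` is lost only if it ends at `v`. Then the sole neighbour of `v` lies in `T`,
so an edge leaving `insert v T` must start in `T`. -/
lemma CutConnected.erase_leaf [DecidableEq α] {H : SimpleGraph α} {S : Finset α}
    (hS : CutConnected H S) {v : α} (hv : v ∈ S) (hleaf : #(nbIn H v S) ≤ 1) :
    CutConnected H (S.erase v) := by
  intro T hT hne
  have hvT : v ∉ T := fun h => by simpa using hT.1 h
  have hTS : T ⊆ S := hT.1.trans (erase_subset _ _)
  have huniq : ∀ a ∈ S, ∀ b ∈ S, H.Adj v a → H.Adj v b → a = b := fun a ha b hb h1 h2 =>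
    card_le_one.1 hleaf a (by simp [ha, h1]) b (by simp [hb, h2])
  obtain ⟨u, hu, w, hw, hwT, huw⟩ :=
    hS T (ssubset_iff_of_subset hTS |>.2 ⟨v, hv, hvT⟩) hne
  by_cases hwv : w = v
  · subst hwv
    obtain ⟨x, hx, hxT⟩ := exists_of_ssubset hT
    rw [mem_erase] at hx
    obtain ⟨a, ha, b, hb, hbT, hab⟩ := hS (insert w T) (ssubset_iff_of_subset
      (insert_subset hv hTS) |>.2 ⟨x, hx.2, by simp [hx.1, hxT]⟩) (insert_nonempty _ _)
    simp only [mem_insert, not_or] at ha hbT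
    rcases ha with rfl | ha
    · exact absurd (huniq b hb u (hTS hu) hab huw.symm ▸ hu) hbT.2
    · exact ⟨a, ha, b, by simp [hb, hbT.1], hbT.2, hab⟩
  · exact ⟨u, hu, w, by simp [hw, hwv], hwT, huw⟩

/-- Keep a vertex of degree at most `d` and discard its neighbours: each kept vertex costs at most
`d + 1` vertices. -/
lemma DegenerateOn.exists_independent {H : SimpleGraph α} {d : ℕ} :
    ∀ S : Finset α, DegenerateOn H S d →
      ∃ I ⊆ S, (∀ u ∈ I, ∀ v ∈ I, ¬ H.Adj u v) ∧ #S ≤ (d + 1) * #I := by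
  classical
  intro S
  induction S using Finset.strongInduction with
  | H S ih =>
    intro hS
    rcases S.eq_empty_or_nonempty with rfl | hne
    · exact ⟨∅, by simp⟩
    obtain ⟨v, hv, hd⟩ := hS S subset_rfl hne
    have hsub : S \ insert v (nbIn H v S) ⊆ S := sdiff_subset
    obtain ⟨I, hI, hind, hcard⟩ := ih (S \ insert v (nbIn H v S))
      (ssubset_iff_of_subset hsub |>.2 ⟨v, hv, by simp⟩) (hS.subset hsub)
    have hvI : v ∉ I := fun h => by simpa using hI h
    have hadj : ∀ u ∈ I, ¬ H.Adj v u := fun u hu h => by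
      have := hI hu
      simp only [mem_sdiff, mem_insert, mem_nbIn] at this
      exact this.2 (Or.inr ⟨this.1, h⟩)
    refine ⟨insert v I, insert_subset hv (hI.trans hsub), ?_, ?_⟩
    · intro a ha b hb hab
      rw [mem_insert] at ha hb
      rcases ha with rfl | ha <;> rcases hb with rfl | hb
      · exact H.irrefl hab
      · exact hadj b hb hab
      · exact hadj a ha hab.symm
      · exact hind a ha b hb hab
    · rw [card_insert_of_notMem hvI]
      have h1 : #S ≤ #(S \ insert v (nbIn H v S)) + #(insert v (nbIn H v S)) := by
        have := le_card_sdiff (insert v (nbIn H v S)) S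
        omega
      have h2 := card_insert_le v (nbIn H v S)
      linarith

lemma DegenerateOn.sum_nbIn_le {H : SimpleGraph α} {d : ℕ} :
    ∀ S : Finset α, DegenerateOn H S d → ∑ x ∈ S, #(nbIn H x S) ≤ 2 * d * #S := by
  classical
  intro S
  induction S using Finset.strongInduction with
  | H S ih =>
    intro hS
    rcases S.eq_empty_or_nonempty with rfl | hne
    · simp
    obtain ⟨v, hv, hd⟩ := hS S subset_rfl hne
    have h1 := ih (S.erase v) (erase_ssubset hv) (hS.subset (erase_subset _ _))
    have h2 := sum_nbIn_insert H (notMem_erase v S)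
    rw [insert_erase hv] at h2
    have h3 := card_erase_add_one hv
    have h4 := card_le_card (nbIn_mono H v (erase_subset v S))
    rw [h2, ← h3]
    nlinarith

/-! ### Paths and cycles. -/

/-- Many neighbours everywhere give a long path. -/
lemma exists_path {H : SimpleGraph α} {S : Finset α} (hne : S.Nonempty) {m : ℕ}
    (hdeg : ∀ v ∈ S, m ≤ #(nbIn H v S)) :
    ∃ p : ℕ → α, Set.InjOn p (Set.Iic m) ∧ (∀ i ≤ m, p i ∈ S) ∧
      ∀ i < m, H.Adj (p i) (p (i + 1)) := by
  classical
  suffices h : ∀ j ≤ m, ∃ p : ℕ → α, Set.InjOn p (Set.Iic j) ∧ (∀ i ≤ j, p i ∈ S) ∧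
      ∀ i < j, H.Adj (p i) (p (i + 1)) from h m le_rfl
  intro j
  induction j with
  | zero =>
    intro _
    obtain ⟨v, hv⟩ := hne
    refine ⟨fun _ => v, ?_, fun _ _ => hv, fun i hi => by omega⟩
    intro a ha b hb _
    simp only [Set.mem_Iic] at ha hb
    omega
  | succ j ih =>
    intro hj
    obtain ⟨p, hinj, hmem, hadj⟩ := ih (by omega)
    -- The endpoint `p j` is not its own neighbour, so only the `j` earlier vertices are to be
    -- avoided.
    have hex : ∃ w ∈ nbIn H (p j) S, w ∉ (range j).image p := by
      apply exists_mem_notMem_of_card_lt_card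
      have h1 := hdeg (p j) (hmem j le_rfl)
      have h2 := card_image_le (s := range j) (f := p)
      rw [card_range] at h2
      omega
    obtain ⟨w, hw, hwn⟩ := hex
    rw [mem_nbIn] at hw
    have hwp : ∀ i ≤ j, p i ≠ w := by
      intro i hi h
      rcases hi.lt_or_eq with h' | rfl
      · exact hwn (mem_image.2 ⟨i, mem_range.2 h', h⟩)
      · rw [h] at hw
        exact H.irrefl hw.2
    refine ⟨Function.update p (j + 1) w, ?_, ?_, ?_⟩
    · intro a ha b hb hab
      simp only [Set.mem_Iic] at ha hb
      by_cases h1 : a = j + 1 <;> by_cases h2 : b = j + 1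
      · omega
      · subst h1
        rw [Function.update_self, Function.update_of_ne h2] at hab
        exact absurd hab.symm (hwp b (by omega))
      · subst h2
        rw [Function.update_self, Function.update_of_ne h1] at hab
        exact absurd hab (hwp a (by omega))
      · rw [Function.update_of_ne h1, Function.update_of_ne h2] at hab
        exact hinj (Set.mem_Iic.2 (by omega)) (Set.mem_Iic.2 (by omega)) hab
    · intro i hi
      by_cases h1 : i = j + 1
      · subst h1
        simpa using hw.1
      · rw [Function.update_of_ne h1]
        exact hmem i (by omega)
    · intro i hi
      rw [Function.update_of_ne (by omega : i ≠ j + 1)]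
      by_cases h1 : i = j
      · subst h1
        simpa using hw.2
      · rw [Function.update_of_ne (by omega : i + 1 ≠ j + 1)]
        exact hadj i (by omega)

lemma cycle_isContained {H : SimpleGraph α} {k : ℕ} (hk : 3 ≤ k) (p : ℕ → α)
    (hinj : Set.InjOn p (Set.Iio k)) (hadj : ∀ i, i + 1 < k → H.Adj (p i) (p (i + 1)))
    (hclose : H.Adj (p (k - 1)) (p 0)) : (SimpleGraph.cycleGraph k).IsContained H := by
  obtain ⟨m, rfl⟩ : ∃ m, k = m + 3 := ⟨k - 3, by omega⟩
  have key : ∀ i j : Fin (m + 3), j = i + 1 → H.Adj (p i) (p j) := by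
    rintro i j rfl
    rw [Fin.val_add_one]
    split_ifs with h
    · subst h
      simpa using hclose
    · have : (i : ℕ) ≠ m + 2 := fun h' => h (Fin.ext (by simpa using h'))
      exact hadj i (by omega)
  refine ⟨⟨⟨fun i => p i, ?_⟩, ?_⟩⟩
  · intro i j hij
    rw [SimpleGraph.cycleGraph_adj] at hij
    rcases hij with h | h
    · exact (key j i (sub_eq_iff_eq_add'.1 h)).symm
    · exact key i j (sub_eq_iff_eq_add'.1 h)
  · intro i j hij
    exact Fin.ext (hinj (Set.mem_Iio.2 i.2) (Set.mem_Iio.2 j.2) hij)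

/-- Neighbourhoods in a `C_k`-free graph are `(k - 3)`-degenerate. -/
lemma degenerateOn_of_cycle_free {H : SimpleGraph α} {k : ℕ} (hk : 3 ≤ k)
    (hfree : ¬ (SimpleGraph.cycleGraph k).IsContained H) {v : α} {A : Finset α}
    (hA : ∀ a ∈ A, H.Adj v a) : DegenerateOn H A (k - 3) := by
  intro T hT hne
  by_contra! hcon
  -- All degrees in `T` are at least `k - 2`, which gives a path on `k - 1` vertices; `v` closes it
  -- to a `C_k`.
  obtain ⟨p, hinj, hmem, hadj⟩ := exists_path (H := H) hne (m := k - 2) fun x hx => by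
    have := hcon x hx
    omega
  have hpv : ∀ i ≤ k - 2, H.Adj v (p i) := fun i hi => hA _ (hT (hmem i hi))
  refine hfree (cycle_isContained hk (fun i => if i = 0 then v else p (i - 1)) ?_ ?_ ?_)
  · intro a ha b hb hab
    simp only [Set.mem_Iio] at ha hb
    dsimp only at hab
    split_ifs at hab with h1 h2 h2
    · omega
    · exact absurd hab (hpv _ (by omega)).ne
    · exact absurd hab.symm (hpv _ (by omega)).ne
    · have := hinj (Set.mem_Iic.2 (by omega)) (Set.mem_Iic.2 (by omega)) hab
      omega
  · intro i hi
    by_cases h : i = 0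
    · subst h
      simpa using hpv 0 (by omega)
    · have := hadj (i - 1) (by omega)
      rw [Nat.sub_add_cancel (by omega)] at this
      simpa [h] using this
  · have : k - 1 ≠ 0 := by omega
    simpa [this] using (hpv (k - 1 - 1) (by omega)).symm

lemma cycle_isContained_of_clique {H : SimpleGraph α} {k : ℕ} (hk : 3 ≤ k) {S : Finset α}
    (hS : k ≤ #S) (hcl : ∀ u ∈ S, ∀ v ∈ S, u ≠ v → H.Adj u v) :
    (SimpleGraph.cycleGraph k).IsContained H := by
  classical
  have hne : S.Nonempty := card_pos.1 (by omega)
  obtain ⟨f, hf⟩ : ∃ f : Fin k → α, Function.Injective f ∧ ∀ i, f i ∈ S :=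
    ⟨fun i => S.equivFin.symm (Fin.castLE hS i), fun i j h => by
      simpa [Subtype.val_inj] using h, fun i => (S.equivFin.symm _).2⟩
  refine ⟨⟨⟨f, ?_⟩, hf.1⟩⟩
  intro i j hij
  exact hcl _ (hf.2 i) _ (hf.2 j) (fun h => hij.ne (hf.1 h))

/-! ### Distinct representatives and greedy embeddings. -/

/-- A finite family of large sets has distinct representatives. -/
lemma exists_distinct_representatives {ι β : Type*} [Nonempty β] (I : Finset ι)
    (t : ι → Finset β) (ht : ∀ i ∈ I, #I ≤ #(t i)) :
    ∃ f : ι → β, Set.InjOn f I ∧ ∀ i ∈ I, f i ∈ t i := by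
  classical
  obtain ⟨f, hinj, hf⟩ := (Finset.all_card_le_biUnion_card_iff_exists_injective
    (fun i : I => t i)).1 (by
      intro A
      rcases A.eq_empty_or_nonempty with rfl | ⟨a, ha⟩
      · simp
      · calc #A ≤ #I := by simpa using card_le_univ A
          _ ≤ #(t a) := ht a a.2
          _ ≤ _ := card_le_card (subset_biUnion_of_mem (fun i : I => t i) ha))
  refine ⟨fun i => if h : i ∈ I then f ⟨i, h⟩ else Classical.arbitrary β, ?_, ?_⟩
  · intro a ha b hb hab
    simp only [mem_coe] at ha hb
    simp only [ha, hb, dif_pos] at hab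
    simpa using hinj hab
  · intro i hi
    simp only [hi, dif_pos]
    exact hf ⟨i, hi⟩

/-- `φ` embeds the subgraph of `G` induced on `S` into `F`. -/
def IsEmb (G : SimpleGraph V) (F : SimpleGraph W) (S : Finset V) (φ : V → W) : Prop :=
  Set.InjOn φ S ∧ ∀ u ∈ S, ∀ v ∈ S, G.Adj u v → F.Adj (φ u) (φ v)

lemma IsEmb.isContained [Fintype V] {G : SimpleGraph V} {F : SimpleGraph W} {φ : V → W}
    (h : IsEmb G F univ φ) : G.IsContained F :=
  ⟨⟨⟨φ, fun {a b} hab => h.2 a (mem_univ _) b (mem_univ _) hab⟩, fun a b hab =>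
    h.1 (by simp) (by simp) hab⟩⟩

lemma IsEmb.insert [DecidableEq V] {G : SimpleGraph V} {F : SimpleGraph W} {S : Finset V}
    {φ : V → W} (h : IsEmb G F S φ) {v : V} (hv : v ∉ S) {w : W} (hw : ∀ u ∈ S, φ u ≠ w)
    (hadj : ∀ u ∈ S, G.Adj v u → F.Adj (φ u) w) :
    IsEmb G F (insert v S) (Function.update φ v w) := by
  have hne : ∀ u ∈ S, u ≠ v := fun u hu h => hv (h ▸ hu)
  constructor
  · intro a ha b hb hab
    simp only [coe_insert, Set.mem_insert_iff, mem_coe] at ha hb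
    rcases ha with rfl | ha <;> rcases hb with rfl | hb
    · rfl
    · rw [Function.update_self, Function.update_of_ne (hne b hb)] at hab
      exact absurd hab.symm (hw b hb)
    · rw [Function.update_self, Function.update_of_ne (hne a ha)] at hab
      exact absurd hab (hw a ha)
    · rw [Function.update_of_ne (hne a ha), Function.update_of_ne (hne b hb)] at hab
      exact h.1 ha hb hab
  · intro a ha b hb hab
    rw [mem_insert] at ha hb
    rcases ha with rfl | ha <;> rcases hb with rfl | hb
    · exact absurd hab G.irrefl
    · rw [Function.update_self, Function.update_of_ne (hne b hb)]
      exact (hadj b hb hab).symm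
    · rw [Function.update_self, Function.update_of_ne (hne a ha)]
      exact hadj a ha hab.symm
    · rw [Function.update_of_ne (hne a ha), Function.update_of_ne (hne b hb)]
      exact h.2 a ha b hb hab

/-- A free common neighbour of the images of few vertices of small co-degree. -/
lemma exists_free_vertex {G : SimpleGraph V} {F : SimpleGraph W} {S : Finset V} {φ : V → W}
    {v : V} {A : Finset W} {d D : ℕ} (hd : #(nbIn G v S) ≤ d)
    (hD : ∀ u ∈ nbIn G v S, #(nbIn Fᶜ (φ u) A) ≤ D) (hA : #S + d * D < #A) :
    ∃ w ∈ A, (∀ u ∈ S, φ u ≠ w) ∧ ∀ u ∈ S, G.Adj v u → F.Adj (φ u) w := by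
  classical
  have hex : ∃ w ∈ A, w ∉ S.image φ ∪ (nbIn G v S).biUnion fun u => nbIn Fᶜ (φ u) A := by
    apply exists_mem_notMem_of_card_lt_card
    have h1 := card_union_le (S.image φ) ((nbIn G v S).biUnion fun u => nbIn Fᶜ (φ u) A)
    have h2 := card_image_le (s := S) (f := φ)
    have h3 := card_biUnion_le_card_mul (nbIn G v S) (fun u => nbIn Fᶜ (φ u) A) D hD
    have h4 := Nat.mul_le_mul_right D hd
    omega
  obtain ⟨w, hw, hwn⟩ := hex
  simp only [mem_union, mem_image, mem_biUnion, not_or, not_exists, not_and, mem_nbIn,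
    SimpleGraph.compl_adj, and_imp] at hwn
  refine ⟨w, hw, hwn.1, fun u hu huv => ?_⟩
  by_contra hF
  exact hwn.2 u hu huv hw (hwn.1 u hu) hF

/-- Greedy extension of an embedding of `T₀` to one of `T`, new vertices going to `A`. -/
lemma exists_isEmb_greedy [DecidableEq V] {G : SimpleGraph V} {F : SimpleGraph W}
    {T₀ T : Finset V}
    (hT : T₀ ⊆ T) {φ₀ : V → W} (h₀ : IsEmb G F T₀ φ₀) {P : W → Prop} (hP₀ : ∀ u ∈ T₀, P (φ₀ u))
    {A : Finset W} {d D : ℕ} (hD : ∀ x, P x → #(nbIn Fᶜ x A) ≤ D)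
    (hdeg : ∀ S, T₀ ⊆ S → S ⊆ T → S ≠ T₀ → ∃ v ∈ S, v ∉ T₀ ∧ #(nbIn G v S) ≤ d)
    (hAP : ∀ v ∈ T, v ∉ T₀ → ∀ u ∈ nbIn G v T, u ∉ T₀ → ∀ x ∈ A, P x)
    (hcard : #T + d * D ≤ #A) :
    ∃ φ, IsEmb G F T φ ∧ (∀ u ∈ T₀, φ u = φ₀ u) ∧ ∀ u ∈ T, u ∉ T₀ → φ u ∈ A := by
  suffices h : ∀ m, ∀ S, #S = m → T₀ ⊆ S → S ⊆ T →
      ∃ φ, IsEmb G F S φ ∧ (∀ u ∈ T₀, φ u = φ₀ u) ∧ ∀ u ∈ S, u ∉ T₀ → φ u ∈ A from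
    h _ T rfl hT subset_rfl
  intro m
  induction m with
  | zero =>
    intro S hS h1 _
    rw [card_eq_zero] at hS
    subst hS
    rw [subset_empty] at h1
    subst h1
    exact ⟨φ₀, h₀, by simp, by simp⟩
  | succ m ih =>
    intro S hS h1 h2
    by_cases hST : S = T₀
    · subst hST
      exact ⟨φ₀, h₀, fun _ _ => rfl, fun u hu h => absurd hu h⟩
    obtain ⟨v, hv, hv0, hvd⟩ := hdeg S h1 h2 hST
    obtain ⟨φ, hφ, hφ0, hφA⟩ := ih (S.erase v) (by rw [card_erase_of_mem hv]; omega)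
      (fun u hu => mem_erase.2 ⟨fun h => hv0 (h ▸ hu), h1 hu⟩) ((erase_subset _ _).trans h2)
    have hsub := nbIn_mono G v (erase_subset v S)
    obtain ⟨w, hwA, hw1, hw2⟩ := exists_free_vertex (F := F) (φ := φ) (A := A) (D := D)
      ((card_le_card hsub).trans hvd) (by
        intro u hu
        apply hD
        have huS := nbIn_subset _ _ _ hu
        by_cases hu0 : u ∈ T₀
        · rw [hφ0 u hu0]
          exact hP₀ u hu0
        -- A new vertex needs `P` only if it is adjacent to another new one, so an independent set
        -- of new vertices may use all of `A`.
        · exact hAP v (h2 hv) hv0 u (nbIn_mono G v h2 (hsub hu)) hu0 _ (hφA u huS hu0)) (by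
        have h3 := card_le_card h2
        have h4 := card_erase_add_one hv
        omega)
    have := hφ.insert (notMem_erase v S) hw1 hw2
    rw [insert_erase hv] at this
    refine ⟨_, this, fun u hu => ?_, fun u hu hu0 => ?_⟩
    · rw [Function.update_of_ne (ne_of_mem_of_not_mem hu hv0), hφ0 u hu]
    · by_cases h : u = v
      · subst h
        rwa [Function.update_self]
      · rw [Function.update_of_ne h]
        exact hφA u (mem_erase.2 ⟨h, hu⟩) hu0

lemma exists_isEmb_of_clique [Nonempty W] (G : SimpleGraph V) {F : SimpleGraph W} {T : Finset V}
    {Q : Finset W} (hQ : ∀ u ∈ Q, ∀ v ∈ Q, u ≠ v → F.Adj u v) (hcard : #T ≤ #Q) :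
    ∃ φ, IsEmb G F T φ ∧ ∀ u ∈ T, φ u ∈ Q := by
  obtain ⟨f, hf, hfQ⟩ := exists_distinct_representatives T (fun _ => Q) (fun _ _ => hcard)
  exact ⟨f, ⟨hf, fun u hu v hv huv => hQ _ (hfQ u hu) _ (hfQ v hv) fun h =>
    huv.ne (hf hu hv h)⟩, hfQ⟩

/-! ### Linear forests and listings with few breaks. -/

/-- A linear forest can be laid out on a line with adjacent vertices at consecutive positions. -/
lemma exists_line_layout (H : SimpleGraph α) : ∀ U : Finset α,
    DegenerateOn H U 1 → (∀ u ∈ U, #(nbIn H u U) ≤ 2) →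
    ∃ pos : α → ℕ, Set.InjOn pos U ∧ (∀ u ∈ U, pos u < #U) ∧
      ∀ u ∈ U, ∀ v ∈ U, H.Adj u v → pos u = pos v + 1 ∨ pos v = pos u + 1 := by
  classical
  intro U
  induction hm : #U generalizing U with
  | zero =>
    intro _ _
    rw [card_eq_zero] at hm
    subst hm
    exact ⟨fun _ => 0, by simp⟩
  | succ m ih =>
    intro hdeg htwo
    obtain ⟨u, hu, hu1⟩ := hdeg U subset_rfl (card_pos.1 (by omega))
    obtain ⟨pos, hinj, hlt, hadj⟩ := ih (U.erase u) (by rw [card_erase_of_mem hu]; omega)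
      (hdeg.subset (erase_subset _ _)) fun x hx =>
        (card_le_card (nbIn_mono H x (erase_subset u U))).trans (htwo x (mem_of_mem_erase hx))
    have hlt' : ∀ x ∈ U, x ≠ u → pos x < m := fun x hx h => hlt x (mem_erase.2 ⟨h, hx⟩)
    have hinj' : ∀ x ∈ U, x ≠ u → ∀ y ∈ U, y ≠ u → pos x = pos y → x = y :=
      fun x hx h y hy h' e => hinj (mem_coe.2 (mem_erase.2 ⟨h, hx⟩))
        (mem_coe.2 (mem_erase.2 ⟨h', hy⟩)) e
    have hadj' : ∀ x ∈ U, x ≠ u → ∀ y ∈ U, y ≠ u → H.Adj x y →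
        pos x = pos y + 1 ∨ pos y = pos x + 1 :=
      fun x hx h y hy h' e => hadj x (mem_erase.2 ⟨h, hx⟩) y (mem_erase.2 ⟨h', hy⟩) e
    have hex : ∃ c ≤ m, (∀ w ∈ U, H.Adj u w → pos w = c ∨ pos w + 1 = c) ∧
        ∀ x ∈ U, x ≠ u → ∀ y ∈ U, y ≠ u → pos x + 1 = c → pos y = c → ¬ H.Adj x y := by
      by_cases hN : ∃ w ∈ U, H.Adj u w
      · obtain ⟨w, hw, huw⟩ := hN
        have hwu : w ≠ u := huw.ne'
        have huniq : ∀ x ∈ U, H.Adj u x → x = w := fun x hx hux =>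
          card_le_one.1 hu1 x (by simp [hx, hux]) w (by simp [hw, huw])
        have hwlt := hlt' w hw hwu
        -- The leaf `u` may be inserted just before or just after `w`. If both places separate
        -- adjacent vertices, `w` has a neighbour on either side and, with `u`, three neighbours.
        by_contra! hcon
        obtain ⟨x, hx, hxu, y, hy, hyu, h1, h2, hxy⟩ := hcon (pos w) (by omega)
          (fun x hx h => Or.inl (by rw [huniq x hx h]))
        obtain ⟨x', hx', hxu', y', hy', hyu', h1', h2', hxy'⟩ := hcon (pos w + 1) (by omega)
          (fun x hx h => Or.inr (by rw [huniq x hx h]))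
        have e1 : y = w := hinj' y hy hyu w hw hwu h2
        have e2 : x' = w := hinj' x' hx' hxu' w hw hwu (by omega)
        subst e1
        subst e2
        have hsub : ({u, x, y'} : Finset α) ⊆ nbIn H x' U := by
          intro z hz
          simp only [mem_insert, mem_singleton] at hz
          rw [mem_nbIn]
          rcases hz with rfl | rfl | rfl
          · exact ⟨hu, huw.symm⟩
          · exact ⟨hx, hxy.symm⟩
          · exact ⟨hy', hxy'⟩
        have hc := (card_le_card hsub).trans (htwo x' hx')
        have hxy'' : x ≠ y' := fun h => by subst h; omega
        rw [card_insert_of_notMem (by simp [hxu.symm, hyu'.symm]), card_pair hxy''] at hc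
        omega
      · push Not at hN
        refine ⟨m, le_rfl, fun w hw h => absurd h (hN w hw), fun x _ _ y hy hyu _ h => ?_⟩
        have := hlt' y hy hyu
        omega
    obtain ⟨c, hcm, hc1, hc2⟩ := hex
    refine ⟨fun x => if x = u then c else if c ≤ pos x then pos x + 1 else pos x, ?_, ?_, ?_⟩
    · intro x hx y hy hxy
      simp only [mem_coe] at hx hy
      dsimp only at hxy
      by_cases h1 : x = u <;> by_cases h2 : y = u
      · rw [h1, h2]
      · rw [if_pos h1, if_neg h2] at hxy
        split_ifs at hxy <;> omega
      · rw [if_neg h1, if_pos h2] at hxy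
        split_ifs at hxy <;> omega
      · rw [if_neg h1, if_neg h2] at hxy
        apply hinj' x hx h1 y hy h2
        split_ifs at hxy <;> omega
    · intro x hx
      dsimp only
      by_cases h1 : x = u
      · rw [if_pos h1]
        omega
      · rw [if_neg h1]
        have := hlt' x hx h1
        split_ifs <;> omega
    · intro x hx y hy hxy
      dsimp only
      by_cases h1 : x = u <;> by_cases h2 : y = u
      · exact absurd (h1.trans h2.symm) hxy.ne
      · subst h1
        rw [if_pos rfl, if_neg h2]
        have := hc1 y hy hxy
        split_ifs <;> omega
      · subst h2
        rw [if_pos rfl, if_neg h1]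
        have := hc1 x hx hxy.symm
        split_ifs <;> omega
      · rw [if_neg h1, if_neg h2]
        have h3 := hadj' x hx h1 y hy h2 hxy
        have h4 := hc2 x hx h1 y hy h2
        have h5 := hc2 y hy h2 x hx h1
        have h6 := hxy.symm
        split_ifs <;> first | omega | (rcases h3 with h3 | h3 <;> first | omega | (exfalso; first | exact h4 (by omega) (by omega) hxy | exact h5 (by omega) (by omega) h6))

open Classical in
/-- The places at which the sequence `x 0, …, x (M - 1)` is not a path. -/
noncomputable def breaks (F : SimpleGraph α) (x : ℕ → α) (M : ℕ) : Finset ℕ :=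
  (range (M - 1)).filter fun i => ¬ F.Adj (x i) (x (i + 1))

lemma mem_breaks {F : SimpleGraph α} {x : ℕ → α} {M i : ℕ} :
    i ∈ breaks F x M ↔ i + 1 < M ∧ ¬ F.Adj (x i) (x (i + 1)) := by
  classical
  simp only [breaks, mem_filter, mem_range]
  constructor <;> rintro ⟨h, h'⟩ <;> exact ⟨by omega, h'⟩

/-- Reversing the segment from the start `p` of a run to the break `b` removes that break. -/
lemma breaks_reverse_lt {F : SimpleGraph α} {x : ℕ → α} {M p b : ℕ} (hb : b ∈ breaks F x M)
    (hpb : p ≤ b) (hp : p = 0 ∨ p - 1 ∈ breaks F x M) (hadj : F.Adj (x p) (x (b + 1))) :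
    #(breaks F (fun i => if p ≤ i ∧ i ≤ b then x (p + b - i) else x i) M) < #(breaks F x M) := by
  have hbM := (mem_breaks.1 hb).1
  have hlt : #((breaks F x M).erase b) < #(breaks F x M) := card_erase_lt_of_mem hb
  refine lt_of_le_of_lt ?_ hlt
  -- Gap `i` inside the reversed segment was gap `p + b - 1 - i` before. Gap `p - 1`, if present,
  -- was already a break, and gap `b` is now the edge from `x p` to `x (b + 1)`.
  apply card_le_card_of_injOn (fun i => if p ≤ i ∧ i < b then p + b - 1 - i else i)
  · intro i hi
    rw [mem_coe, mem_breaks] at hi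
    obtain ⟨h1, h2⟩ := hi
    simp only [mem_coe, mem_erase]
    by_cases h3 : p ≤ i ∧ i < b
    · rw [if_pos h3]
      refine ⟨by omega, mem_breaks.2 ⟨by omega, fun h => h2 ?_⟩⟩
      rw [if_pos (by omega), if_pos (by omega)]
      have e1 : p + b - i = p + b - 1 - i + 1 := by omega
      have e2 : p + b - (i + 1) = p + b - 1 - i := by omega
      rw [e1, e2]
      exact h.symm
    · rw [if_neg h3]
      have hib : i ≠ b := by
        rintro rfl
        rw [if_pos (by omega), if_neg (by omega)] at h2
        have : p + i - i = p := by omega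
        rw [this] at h2
        exact h2 hadj
      refine ⟨hib, ?_⟩
      by_cases h4 : i + 1 = p
      · rcases hp with hp | hp
        · omega
        · rwa [← h4, Nat.add_sub_cancel] at hp
      · rw [if_neg (by omega), if_neg (by omega)] at h2
        exact mem_breaks.2 ⟨h1, h2⟩
  · intro i _ j _ hij
    dsimp only at hij
    split_ifs at hij <;> omega

/-- If `Fᶜ` has no `C_k`, any finite set of vertices is covered by at most `k - 1` paths of `F`. -/
lemma exists_listing_few_breaks {F : SimpleGraph α} {k : ℕ} (hk : 3 ≤ k)
    (hfree : ¬ (SimpleGraph.cycleGraph k).IsContained Fᶜ) [Nonempty α] (X : Finset α) :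
    ∃ x : ℕ → α, Set.InjOn x (Set.Iio #X) ∧ (∀ i < #X, x i ∈ X) ∧ #(breaks F x #X) ≤ k - 2 := by
  classical
  suffices h : ∀ r, ∀ x : ℕ → α, Set.InjOn x (Set.Iio #X) → (∀ i < #X, x i ∈ X) →
      #(breaks F x #X) = r → ∃ x : ℕ → α, Set.InjOn x (Set.Iio #X) ∧ (∀ i < #X, x i ∈ X) ∧
        #(breaks F x #X) ≤ k - 2 by
    obtain ⟨x, h1, h2⟩ := exists_distinct_representatives (range #X) (fun _ => X) (by simp)
    exact h _ x (by simpa using h1) (by simpa using h2) rfl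
  intro r
  induction r using Nat.strong_induction_on with
  | _ r ih =>
    intro x hinj hmem hr
    by_cases hle : r ≤ k - 2
    · exact ⟨x, hinj, hmem, hr ▸ hle⟩
    have hM : 0 < #X := by
      obtain ⟨i, hi⟩ := card_pos.1 (by omega : 0 < #(breaks F x #X))
      have := (mem_breaks.1 hi).1
      omega
    -- The starts of the runs: at least `k` of them, so if no two were adjacent in `F` they would
    -- span a `C_k` in `Fᶜ`.
    set St : Finset ℕ := insert 0 ((breaks F x #X).image (· + 1)) with hSt
    have hStM : ∀ i ∈ St, i < #X := by
      intro i hi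
      simp only [hSt, mem_insert, mem_image] at hi
      rcases hi with rfl | ⟨j, hj, rfl⟩
      · exact hM
      · exact (mem_breaks.1 hj).1
    have hStc : #St = r + 1 := by
      rw [hSt, card_insert_of_notMem (by simp), card_image_of_injective _ (add_left_injective 1),
        hr]
    have hex : ∃ p ∈ St, ∃ q ∈ St, p < q ∧ F.Adj (x p) (x q) := by
      by_contra! hcon
      refine hfree (cycle_isContained_of_clique hk (S := St.image x) ?_ ?_)
      · rw [card_image_of_injOn (fun i hi j hj h => hinj (hStM i hi) (hStM j hj) h)]
        omega
      · intro u hu v hv huv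
        obtain ⟨i, hi, rfl⟩ := mem_image.1 hu
        obtain ⟨j, hj, rfl⟩ := mem_image.1 hv
        refine (SimpleGraph.compl_adj _ _ _).2 ⟨huv, fun h => ?_⟩
        rcases lt_trichotomy i j with h' | rfl | h'
        · exact hcon i hi j hj h' h
        · exact huv rfl
        · exact hcon j hj i hi h' h.symm
    obtain ⟨p, hp, q, hq, hpq, hadj⟩ := hex
    have hqM := hStM q hq
    have hp' : p = 0 ∨ p - 1 ∈ breaks F x #X := by
      simp only [hSt, mem_insert, mem_image] at hp
      rcases hp with hp | ⟨j, hj, rfl⟩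
      · exact Or.inl hp
      · exact Or.inr (by simpa using hj)
    have hq' : q - 1 ∈ breaks F x #X := by
      simp only [hSt, mem_insert, mem_image] at hq
      rcases hq with hq | ⟨j, hj, rfl⟩
      · omega
      · simpa using hj
    have hlt := breaks_reverse_lt hq' (p := p) (by omega) hp'
      (by rwa [Nat.sub_add_cancel (by omega)])
    refine ih _ (hr ▸ hlt) _ ?_ ?_ rfl
    · intro i hi j hj hij
      simp only [Set.mem_Iio] at hi hj
      dsimp only at hij
      split_ifs at hij with h1 h2 h2
      · have := hinj (Set.mem_Iio.2 (by omega)) (Set.mem_Iio.2 (by omega)) hij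
        omega
      · have := hinj (Set.mem_Iio.2 (by omega)) (Set.mem_Iio.2 (by omega)) hij
        omega
      · have := hinj (Set.mem_Iio.2 (by omega)) (Set.mem_Iio.2 (by omega)) hij
        omega
      · exact hinj hi hj hij
    · intro i hi
      split_ifs
      · exact hmem _ (by omega)
      · exact hmem i hi

/-! ### Cycles through common neighbours. -/

/-- In a `C_k`-free graph, vertices with pairwise many common neighbours in a disjoint set are
pairwise nonadjacent. -/
lemma not_adj_of_common_neighbours {H : SimpleGraph α} {k : ℕ} (hk : 3 ≤ k)
    (hfree : ¬ (SimpleGraph.cycleGraph k).IsContained H) {Z Q : Finset α} (hZ : k ≤ #Z)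
    (hZQ : ∀ z ∈ Z, z ∉ Q) (hcommon : ∀ z ∈ Z, ∀ z' ∈ Z, k ≤ #(nbIn H z (nbIn H z' Q))) :
    ∀ z ∈ Z, ∀ z' ∈ Z, ¬ H.Adj z z' := by
  classical
  intro z₀ h₀ z₁ h₁ hadj
  have : Nonempty α := ⟨z₀⟩
  -- The cycle runs `z 0, a 0, z 1, …, z (m - 1)` with `a i` a common neighbour of successive `z`'s.
  -- For even `k` it returns through `a (m - 1)`, for odd `k` along the assumed edge `z₁ z₀`.
  obtain ⟨m, hm2, hm⟩ : ∃ m, 2 ≤ m ∧ (k = 2 * m ∨ k + 1 = 2 * m) :=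
    ⟨(k + 1) / 2, by omega, by omega⟩
  obtain ⟨g, hg, hgm⟩ := exists_distinct_representatives (range (m - 2))
    (fun _ => (Z.erase z₀).erase z₁) (by
      intro i _
      rw [card_range, card_erase_of_mem (mem_erase.2 ⟨hadj.ne', h₁⟩), card_erase_of_mem h₀]
      omega)
  have hgm' : ∀ i < m - 2, g i ≠ z₁ ∧ g i ≠ z₀ ∧ g i ∈ Z := fun i hi => by
    simpa using hgm i (mem_range.2 hi)
  have hg' : ∀ i < m - 2, ∀ j < m - 2, g i = g j → i = j := fun i hi j hj h =>
    hg (by simpa using hi) (by simpa using hj) h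
  obtain ⟨z, hz0, hz1, hzZ, hzinj⟩ : ∃ z : ℕ → α, z 0 = z₀ ∧ z (m - 1) = z₁ ∧
      (∀ i < m, z i ∈ Z) ∧ ∀ i < m, ∀ j < m, z i = z j → i = j := by
    refine ⟨fun i => if i = 0 then z₀ else if i = m - 1 then z₁ else g (i - 1), by simp, ?_, ?_, ?_⟩
    · dsimp only
      rw [if_neg (by omega), if_pos rfl]
    · intro i hi
      dsimp only
      split_ifs
      · exact h₀
      · exact h₁
      · exact (hgm' _ (by omega)).2.2
    · intro i hi j hj hij
      dsimp only at hij
      split_ifs at hij with h1 h2 h3 h4 h5 h6 h7 h8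
      · omega
      · exact absurd hij hadj.ne
      · exact absurd hij.symm (hgm' _ (by omega)).2.1
      · exact absurd hij hadj.ne'
      · omega
      · exact absurd hij.symm (hgm' _ (by omega)).1
      · exact absurd hij (hgm' _ (by omega)).2.1
      · exact absurd hij (hgm' _ (by omega)).1
      · have := hg' _ (by omega) _ (by omega) hij
        omega
  obtain ⟨a, ha, ham⟩ := exists_distinct_representatives (range m)
    (fun i => nbIn H (z i) (nbIn H (z (if i + 1 < m then i + 1 else 0)) Q)) (by
      intro i hi
      rw [mem_range] at hi
      have := hcommon (z i) (hzZ i hi) (z (if i + 1 < m then i + 1 else 0)) (hzZ _ (by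
        split_ifs <;> omega))
      rw [card_range]
      omega)
  have ha' : ∀ i < m, ∀ j < m, a i = a j → i = j := fun i hi j hj h =>
    ha (by simpa using hi) (by simpa using hj) h
  have ham' : ∀ i < m, a i ∈ Q ∧ H.Adj (z i) (a i) ∧
      H.Adj (z (if i + 1 < m then i + 1 else 0)) (a i) := fun i hi => by
    have := ham i (mem_range.2 hi)
    simp only [mem_nbIn] at this
    exact ⟨this.1.1, this.2, this.1.2⟩
  have hza : ∀ i < m, ∀ j < m, z i ≠ a j := fun i hi j hj h =>
    hZQ _ (hzZ i hi) (h ▸ (ham' j hj).1)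
  refine hfree (cycle_isContained hk (fun j => if j % 2 = 0 then z (j / 2) else a (j / 2)) ?_ ?_ ?_)
  · intro i hi j hj hij
    simp only [Set.mem_Iio] at hi hj
    dsimp only at hij
    split_ifs at hij
    · have := hzinj _ (by omega) _ (by omega) hij
      omega
    · exact absurd hij (hza _ (by omega) _ (by omega))
    · exact absurd hij.symm (hza _ (by omega) _ (by omega))
    · have := ha' _ (by omega) _ (by omega) hij
      omega
  · intro i hi
    by_cases h : i % 2 = 0
    · rw [if_pos h, if_neg (by omega)]
      have e : (i + 1) / 2 = i / 2 := by omega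
      rw [e]
      exact (ham' _ (by omega)).2.1
    · rw [if_neg h, if_pos (by omega)]
      have e : (i + 1) / 2 = i / 2 + 1 := by omega
      have := (ham' (i / 2) (by omega)).2.2
      rw [if_pos (by omega)] at this
      rw [e]
      exact this.symm
  · rw [if_pos (by rfl : 0 % 2 = 0), Nat.zero_div]
    rcases hm with hm | hm
    · rw [if_neg (by omega)]
      have e : (k - 1) / 2 = m - 1 := by omega
      have := (ham' (m - 1) (by omega)).2.2
      rw [if_neg (by omega)] at this
      rw [e]
      exact this.symm
    · rw [if_pos (by omega)]
      have e : (k - 1) / 2 = m - 1 := by omega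
      rw [e, hz0, hz1]
      exact hadj.symm

/-! ### Embedding the core along a listing. -/

/-- A graph of minimum degree two with few excess edges splits into a small set and a linear
forest to which each vertex of the small set sends at most one edge. -/
lemma exists_small_separator {G : SimpleGraph V} {C : Finset V} {l : ℕ} (hne : C.Nonempty)
    (hmin : ∀ v ∈ C, 2 ≤ #(nbIn G v C)) (hconn : CutConnected G C)
    (hsum : ∑ x ∈ C, #(nbIn G x C) ≤ 2 * #C + 2 * l) :
    ∃ S ⊆ C, #S ≤ 8 * l + 3 ∧
      (∀ U ⊆ C, (∀ u ∈ U, u ∉ S) → DegenerateOn G U 1) ∧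
      (∀ u ∈ C, u ∉ S → #(nbIn G u C) ≤ 2) ∧
      ∀ u ∈ S, ∀ U ⊆ C, (∀ u ∈ U, u ∉ S) → #(nbIn G u U) ≤ 1 := by
  classical
  obtain ⟨B, hBC, hBne, hBcard, hB⟩ : ∃ B ⊆ C, B.Nonempty ∧
      #B + ∑ x ∈ B, #(nbIn G x C) ≤ 8 * l + 3 ∧ ∀ u ∈ C, u ∉ B → #(nbIn G u C) = 2 := by
    by_cases hex : ∃ b ∈ C, 3 ≤ #(nbIn G b C)
    · obtain ⟨b, hb, hb3⟩ := hex
      refine ⟨C.filter fun v => 3 ≤ #(nbIn G v C), filter_subset _ _, ⟨b, by simp [hb, hb3]⟩, ?_, ?_⟩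
      -- A degree `δ ≥ 3` satisfies `δ + 1 ≤ 4(δ - 2)`, and the excesses `δ - 2` sum to at most
      -- `2l`; hence `8l`.
      · have h1 := sum_filter_add_sum_filter_not C (fun v => 3 ≤ #(nbIn G v C))
          (fun v => #(nbIn G v C))
        have h2 := card_filter_add_card_filter_not (s := C) (fun v => 3 ≤ #(nbIn G v C))
        have h3 : #(C.filter fun v => ¬ 3 ≤ #(nbIn G v C)) • 2 ≤
            ∑ x ∈ C.filter (fun v => ¬ 3 ≤ #(nbIn G v C)), #(nbIn G x C) :=
          card_nsmul_le_sum _ _ _ fun x hx => hmin x (mem_filter.1 hx).1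
        have h4 : #(C.filter fun v => 3 ≤ #(nbIn G v C)) • 3 ≤
            ∑ x ∈ C.filter (fun v => 3 ≤ #(nbIn G v C)), #(nbIn G x C) :=
          card_nsmul_le_sum _ _ _ fun x hx => (mem_filter.1 hx).2
        simp only [smul_eq_mul] at h3 h4
        omega
      · intro u hu hnu
        have := hmin u hu
        simp only [mem_filter, not_and, not_le] at hnu
        have := hnu hu
        omega
    -- With all degrees two, any single vertex serves as `B`; it contributes `1 + 2`, the `+ 3` of
    -- the bound.
    · push Not at hex
      obtain ⟨c, hc⟩ := hne
      refine ⟨{c}, by simpa using hc, singleton_nonempty _, ?_, ?_⟩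
      · rw [sum_singleton, card_singleton]
        have := hex c hc
        omega
      · intro u hu _
        have := hmin u hu
        have := hex u hu
        omega
  have hout : ∀ u ∈ C, u ∉ B → ∀ U ⊆ C, ∀ b ∈ C, b ∉ U → G.Adj u b → #(nbIn G u U) ≤ 1 := by
    intro u hu huB U hU b hb hbU hub
    have h1 : nbIn G u U ⊂ nbIn G u C := (ssubset_iff_of_subset (nbIn_mono G u hU)).2
      ⟨b, by simp [hb, hub], by simp [hbU]⟩
    have := card_lt_card h1
    have := hB u hu huB
    omega
  refine ⟨B ∪ B.biUnion fun b => nbIn G b C,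
    union_subset hBC (biUnion_subset.2 fun b _ => nbIn_subset _ _ _), ?_, ?_, ?_, ?_⟩
  · exact (card_union_le _ _).trans ((Nat.add_le_add_left card_biUnion_le _).trans hBcard)
  · intro U hU hUS T hT hTne
    have hTC := hT.trans hU
    obtain ⟨b, hb⟩ := hBne
    have hTB : ∀ t ∈ T, t ∉ B := fun t ht h => hUS t (hT ht) (mem_union_left _ h)
    obtain ⟨u, hu, v, hv, hvT, huv⟩ := hconn T
      ((ssubset_iff_of_subset hTC).2 ⟨b, hBC hb, fun h => hTB b h hb⟩) hTne
    exact ⟨u, hu, hout u (hTC hu) (hTB u hu) T hTC v hv hvT huv⟩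
  · intro u hu huS
    exact (hB u hu fun h => huS (mem_union_left _ h)).le
  · intro u hu U hU hUS
    by_cases huB : u ∈ B
    · have : nbIn G u U = ∅ := by
        ext x
        simp only [mem_nbIn, notMem_empty, iff_false, not_and]
        intro hx hux
        exact hUS x hx (mem_union_right _ (mem_biUnion.2 ⟨u, huB, by simp [hU hx, hux]⟩))
      simp [this]
    · rw [mem_union, mem_biUnion] at hu
      obtain ⟨b, hb, hbu⟩ := hu.resolve_left huB
      rw [mem_nbIn] at hbu
      exact hout u hbu.1 huB U hU b (hBC hb) (fun h => hUS b h (mem_union_left _ hb)) hbu.2.symm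

/-- Embedding a graph that splits into a small set `S` and a linear forest: the forest follows a
listing of the vertices of `F` with few breaks, and a clique of `F` absorbs `S` and the breaks. -/
lemma exists_isEmb_of_listing [Nonempty W] {G : SimpleGraph V} {F : SimpleGraph W} {C S : Finset V}
    (hSC : S ⊆ C) (hforest : ∀ U ⊆ C, (∀ u ∈ U, u ∉ S) → DegenerateOn G U 1)
    (htwo : ∀ u ∈ C, u ∉ S → #(nbIn G u C) ≤ 2)
    (hone : ∀ u ∈ S, ∀ U ⊆ C, (∀ u ∈ U, u ∉ S) → #(nbIn G u U) ≤ 1)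
    {Q X : Finset W} (hQ : ∀ u ∈ Q, ∀ v ∈ Q, u ≠ v → F.Adj u v) (hXQ : ∀ w ∈ X, w ∉ Q)
    {s r : ℕ} (hX : ∀ w ∈ X, s ≤ #(nbIn F w Q)) {x : ℕ → W} (hinj : Set.InjOn x (Set.Iio #X))
    (hmem : ∀ i < #X, x i ∈ X) (hbr : #(breaks F x #X) ≤ r) (hs : #S + 2 * r + 1 ≤ s)
    (hsQ : s ≤ #Q) (hcard : #C + 2 * r + 1 ≤ #X + #Q) :
    ∃ φ, IsEmb G F C φ := by
  classical
  obtain ⟨pos, hpinj, hplt, hpadj⟩ := exists_line_layout G (C \ S)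
    (hforest _ sdiff_subset fun u hu => (mem_sdiff.1 hu).2)
    (fun u hu => (card_le_card (nbIn_mono G u sdiff_subset)).trans
      (htwo u (mem_sdiff.1 hu).1 (mem_sdiff.1 hu).2))
  set Br := breaks F x #X with hBr
  -- Forest vertices that leave the listing: those at either end of a break, at the last place, or
  -- beyond it. The last place is a buffer that keeps vertices beyond the listing from having
  -- neighbours in `O`.
  set S₂ := (C \ S).filter fun u => #X ≤ pos u + 1 ∨ pos u ∈ Br ∨ ∃ j ∈ Br, j + 1 = pos u with hS₂
  set O := (C \ S) \ S₂ with hO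
  have hOmem : ∀ u, u ∈ O ↔ u ∈ C \ S ∧ pos u + 1 < #X ∧ pos u ∉ Br ∧ ∀ j ∈ Br, j + 1 ≠ pos u := by
    intro u
    simp only [hO, hS₂, mem_sdiff, mem_filter]
    push Not
    constructor
    · rintro ⟨h1, h2⟩
      exact ⟨h1, h2 h1⟩
    · rintro ⟨h1, h2⟩
      exact ⟨h1, fun _ => h2⟩
  have hOC : O ⊆ C := fun u hu => (mem_sdiff.1 ((hOmem u).1 hu).1).1
  have hOS : ∀ u ∈ O, u ∉ S := fun u hu => (mem_sdiff.1 ((hOmem u).1 hu).1).2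
  have hOX : ∀ u ∈ O, x (pos u) ∈ X := fun u hu =>
    hmem _ (by have := ((hOmem u).1 hu).2.1; omega)
  -- Only these vertices outside `O` can have neighbours in `O`, so only they have restricted
  -- choices in `Q`.
  set I := S ∪ S₂.filter fun u => pos u < #X with hI
  have hBr1 : #(Br.image (· + 1)) ≤ #Br := card_image_le
  have hS₂card : #S₂ ≤ 2 * r + (#(C \ S) - (#X - 1)) := by
    have h1 : #S₂ ≤ #(Br ∪ Br.image (· + 1) ∪ Ico (#X - 1) #(C \ S)) := by
      apply card_le_card_of_injOn pos
      · intro u hu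
        simp only [hS₂, mem_coe, mem_filter] at hu
        simp only [mem_coe, mem_union, mem_image, mem_Ico]
        have := hplt u hu.1
        rcases hu.2 with h | h | h
        · right; omega
        · exact Or.inl (Or.inl h)
        · exact Or.inl (Or.inr h)
      · intro u hu v hv h
        exact hpinj (mem_coe.2 (mem_filter.1 hu).1) (mem_coe.2 (mem_filter.1 hv).1) h
    have h2 := card_union_le (Br ∪ Br.image (· + 1)) (Ico (#X - 1) #(C \ S))
    have h3 := card_union_le Br (Br.image (· + 1))
    rw [Nat.card_Ico] at h2
    omega
  have hIcard : #I ≤ s := by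
    have h1 : #(S₂.filter fun u => pos u < #X) ≤ #(Br ∪ Br.image (· + 1) ∪ {#X - 1}) := by
      apply card_le_card_of_injOn pos
      · intro u hu
        simp only [hS₂, mem_coe, mem_filter] at hu
        simp only [mem_coe, mem_union, mem_image, mem_singleton]
        rcases hu.1.2 with h | h | h
        · right; omega
        · exact Or.inl (Or.inl h)
        · exact Or.inl (Or.inr h)
      · intro u hu v hv h
        exact hpinj (mem_coe.2 (mem_filter.1 (mem_filter.1 hu).1).1)
          (mem_coe.2 (mem_filter.1 (mem_filter.1 hv).1).1) h
    have h2 := card_union_le (Br ∪ Br.image (· + 1)) {#X - 1}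
    have h3 := card_union_le Br (Br.image (· + 1))
    have h4 := card_union_le S (S₂.filter fun u => pos u < #X)
    rw [card_singleton] at h2
    rw [hI]
    omega
  have hIone : ∀ u ∈ I, #(nbIn G u O) ≤ 1 := by
    intro u hu
    rw [hI, mem_union] at hu
    rcases hu with hu | hu
    · exact hone u hu O hOC hOS
    · have hu₂ := (mem_filter.1 hu).1
      simp only [hS₂, mem_filter] at hu₂
      rw [card_le_one]
      intro a ha b hb
      rw [mem_nbIn, hOmem] at ha hb
      have h1 := hpadj u hu₂.1 a ha.1.1 ha.2
      have h2 := hpadj u hu₂.1 b hb.1.1 hb.2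
      apply hpinj (mem_coe.2 ha.1.1) (mem_coe.2 hb.1.1)
      -- Two neighbours in `O` would lie on both sides of `u`, but the break or the end of the
      -- listing that excludes `u` excludes one of those places too.
      have key : ∀ a b : V, pos u + 1 = pos a → pos u = pos b + 1 →
          (pos a + 1 < #X ∧ pos a ∉ Br ∧ ∀ j ∈ Br, j + 1 ≠ pos a) →
          (pos b + 1 < #X ∧ pos b ∉ Br ∧ ∀ j ∈ Br, j + 1 ≠ pos b) → False := by
        intro a b h3 h4 h5 h6
        rcases hu₂.2 with h | h | ⟨j, hj, h⟩
        · omega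
        · exact h5.2.2 _ h h3
        · have : j = pos b := by omega
          exact h6.2.1 (this ▸ hj)
      by_contra hne
      rcases h1 with h1 | h1 <;> rcases h2 with h2 | h2
      · omega
      · exact key b a h2.symm h1 hb.1.2 ha.1.2
      · exact key a b h1.symm h2 ha.1.2 hb.1.2
      · omega
  obtain ⟨f, hfinj, hf⟩ := exists_distinct_representatives I
    (fun i => Q.filter fun w => ∀ u ∈ nbIn G i O, F.Adj (x (pos u)) w) (by
      intro i hi
      refine hIcard.trans ?_
      rcases (nbIn G i O).eq_empty_or_nonempty with h | ⟨u, hu⟩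
      · simpa [h] using hsQ
      · refine (hX _ (hOX u (nbIn_subset _ _ _ hu))).trans (card_le_card ?_)
        intro w hw
        rw [mem_nbIn] at hw
        rw [mem_filter]
        refine ⟨hw.1, fun u' hu' => ?_⟩
        rw [card_le_one.1 (hIone i hi) u' hu' u hu]
        exact hw.2)
  have hfQ : ∀ i ∈ I, f i ∈ Q := fun i hi => (mem_filter.1 (hf i hi)).1
  have hIsub : I ⊆ C \ O := by
    intro u hu
    rw [hI, mem_union] at hu
    rw [mem_sdiff]
    rcases hu with hu | hu
    · exact ⟨hSC hu, fun h => hOS u h hu⟩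
    · have hu₂ := (mem_filter.1 hu).1
      exact ⟨(mem_sdiff.1 (mem_filter.1 hu₂).1).1, fun h => (mem_sdiff.1 h).2 hu₂⟩
  obtain ⟨g, hginj, hg⟩ := exists_distinct_representatives ((C \ O) \ I)
    (fun _ => Q \ I.image f) (by
      intro i _
      have h1 := card_sdiff_of_subset hIsub
      have h2 := card_sdiff_of_subset (image_subset_iff.2 hfQ)
      rw [card_image_of_injOn hfinj] at h2
      have h3 : #(C \ O) ≤ #S + #S₂ := by
        refine (card_le_card ?_).trans (card_union_le S S₂)
        intro u hu
        simp only [hO, mem_sdiff, mem_union] at hu ⊢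
        tauto
      have h4 := card_sdiff_of_subset hSC
      have h5 := card_le_card hSC
      omega)
  have hgQ : ∀ i ∈ C, i ∉ O → i ∉ I → g i ∈ Q ∧ ∀ j ∈ I, f j ≠ g i := fun i h1 h2 h3 => by
    have := hg i (by simp [h1, h2, h3])
    rw [mem_sdiff, mem_image] at this
    exact ⟨this.1, fun j hj h => this.2 ⟨j, hj, h⟩⟩
  set ψ : V → W := fun u => if u ∈ I then f u else g u with hψ
  have hψQ : ∀ u ∈ C, u ∉ O → ψ u ∈ Q := by
    intro u hu huO
    simp only [hψ]
    split_ifs with h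
    · exact hfQ u h
    · exact (hgQ u hu huO h).1
  have hψinj : ∀ u ∈ C, u ∉ O → ∀ v ∈ C, v ∉ O → ψ u = ψ v → u = v := by
    intro u hu huO v hv hvO h
    simp only [hψ] at h
    split_ifs at h with h1 h2 h2
    · exact hfinj h1 h2 h
    · exact absurd h ((hgQ v hv hvO h2).2 u h1)
    · exact absurd h.symm ((hgQ u hu huO h1).2 v h2)
    · exact hginj (by simp [hu, huO, h1]) (by simp [hv, hvO, h2]) h
  have hψadj : ∀ u ∈ O, ∀ v ∈ C, v ∉ O → G.Adj u v → F.Adj (x (pos u)) (ψ v) := by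
    intro u hu v hv hvO huv
    have hvI : v ∈ I := by
      rw [hI, mem_union, mem_filter]
      by_cases hvS : v ∈ S
      · exact Or.inl hvS
      · have hvCS : v ∈ C \ S := mem_sdiff.2 ⟨hv, hvS⟩
        refine Or.inr ⟨by_contra fun h => hvO (mem_sdiff.2 ⟨hvCS, h⟩), ?_⟩
        have h1 := (hOmem u).1 hu
        have := hpadj u h1.1 v hvCS huv
        omega
    simp only [hψ, if_pos hvI]
    exact (mem_filter.1 (hf v hvI)).2 u (by simp [hu, huv.symm])
  refine ⟨fun u => if u ∈ O then x (pos u) else ψ u, ?_, ?_⟩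
  · intro u hu v hv h
    rw [mem_coe] at hu hv
    dsimp only at h
    split_ifs at h with h1 h2 h2
    · have h3 := (hOmem u).1 h1
      have h4 := (hOmem v).1 h2
      exact hpinj (mem_coe.2 h3.1) (mem_coe.2 h4.1)
        (hinj (Set.mem_Iio.2 (by omega)) (Set.mem_Iio.2 (by omega)) h)
    · exact absurd (hψQ v hv h2) (h ▸ hXQ _ (hOX u h1))
    · exact absurd (hψQ u hu h1) (h ▸ hXQ _ (hOX v h2))
    · exact hψinj u hu h1 v hv h2 h
  · intro u hu v hv huv
    dsimp only
    by_cases h1 : u ∈ O <;> by_cases h2 : v ∈ O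
    · rw [if_pos h1, if_pos h2]
      have h3 := (hOmem u).1 h1
      have h4 := (hOmem v).1 h2
      have key : ∀ i ∉ Br, i + 1 < #X → F.Adj (x i) (x (i + 1)) := fun i hi hiX => by
        by_contra h
        exact hi (mem_breaks.2 ⟨hiX, h⟩)
      rcases hpadj u h3.1 v h4.1 huv with h | h
      · rw [h]
        exact (key _ h4.2.2.1 h4.2.1).symm
      · rw [h]
        exact key _ h3.2.2.1 h3.2.1
    · rw [if_pos h1, if_neg h2]
      exact hψadj u h1 v hv h2 huv
    · rw [if_neg h1, if_pos h2]
      exact (hψadj v h2 u hu h1 huv.symm).symm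
    · rw [if_neg h1, if_neg h2]
      exact hQ _ (hψQ u hu h1) _ (hψQ v hv h2) fun h => huv.ne (hψinj u hu h1 v hv h2 h)

/-! ### The core: large clique or small co-degree. -/

lemma card_nbIn_add_compl (F : SimpleGraph W) {w : W} {Q : Finset W} (hw : w ∉ Q) :
    #(nbIn F w Q) + #(nbIn Fᶜ w Q) = #Q := by
  classical
  rw [← card_filter_add_card_filter_not (s := Q) (fun u => F.Adj w u)]
  have h : nbIn Fᶜ w Q = Q.filter fun u => ¬ F.Adj w u := by
    ext u
    simp only [mem_nbIn, SimpleGraph.compl_adj, mem_filter, and_congr_right_iff,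
      and_iff_right_iff_imp]
    rintro hu - rfl
    exact hw hu
  rw [h]
  congr 2

/-- If `Fᶜ` has no `C_k`, a set inside a neighbourhood of `Fᶜ` has a large clique of `F`. -/
lemma exists_clique_in_nbhd {F : SimpleGraph W} {k : ℕ} (hk : 3 ≤ k)
    (hfree : ¬ (SimpleGraph.cycleGraph k).IsContained Fᶜ) {v : W} {A : Finset W}
    (hA : ∀ a ∈ A, Fᶜ.Adj v a) :
    ∃ Q ⊆ A, (∀ u ∈ Q, ∀ w ∈ Q, u ≠ w → F.Adj u w) ∧ #A ≤ (k - 2) * #Q := by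
  obtain ⟨Q, hQA, hQ, hcard⟩ := (degenerateOn_of_cycle_free hk hfree hA).exists_independent
  refine ⟨Q, hQA, fun u hu w hw huw => ?_, ?_⟩
  · by_contra h
    exact hQ u hu w hw ((SimpleGraph.compl_adj _ _ _).2 ⟨huw, h⟩)
  · rwa [show k - 2 = k - 3 + 1 by omega]

lemma exists_isEmb_core_of_clique [Fintype W] [Nonempty W] {G : SimpleGraph V} {F : SimpleGraph W}
    {C : Finset V} {k l n : ℕ} (hk : 3 ≤ k) (hkn : k ≤ n)
    (hfree : ¬ (SimpleGraph.cycleGraph k).IsContained Fᶜ) (hCn : #C ≤ n) (hne : C.Nonempty)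
    (hmin : ∀ v ∈ C, 2 ≤ #(nbIn G v C)) (hconn : CutConnected G C)
    (hsum : ∑ x ∈ C, #(nbIn G x C) ≤ 2 * #C + 2 * l) (hN : 2 * n + 2 * k ≤ Fintype.card W)
    {Q : Finset W} (hQ : ∀ u ∈ Q, ∀ v ∈ Q, u ≠ v → F.Adj u v) (hQcard : 16 * l + 5 * k ≤ #Q) :
    ∃ φ, IsEmb G F C φ := by
  classical
  -- This is `(8l + 3) + 2(k - 2) + 1`: the separator, both ends of each break, and the last place.
  -- Also `#Q - 2s ≥ k`, which yields the common neighbours in `Z`.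
  set s := 8 * l + 2 * k with hs
  set Z : Finset W := univ.filter fun w => w ∉ Q ∧ #(nbIn F w Q) < s with hZ
  by_cases hZn : n ≤ #Z
  · have hZind := not_adj_of_common_neighbours hk hfree (Z := Z) (Q := Q) (hkn.trans hZn)
      (fun z hz => (mem_filter.1 hz).2.1) (by
        intro z hz z' hz'
        have h1 := (mem_filter.1 hz).2
        have h2 := (mem_filter.1 hz').2
        have h3 := card_nbIn_add_compl F h1.1
        have h4 := card_nbIn_add_compl F h2.1
        have h5 := card_union_add_card_inter (nbIn Fᶜ z Q) (nbIn Fᶜ z' Q)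
        have h6 := card_le_card (union_subset (nbIn_subset Fᶜ z Q) (nbIn_subset Fᶜ z' Q))
        have h7 : nbIn Fᶜ z Q ∩ nbIn Fᶜ z' Q ⊆ nbIn Fᶜ z (nbIn Fᶜ z' Q) := by
          intro u hu
          rw [mem_inter, mem_nbIn, mem_nbIn] at hu
          rw [mem_nbIn, mem_nbIn]
          exact ⟨hu.2, hu.1.2⟩
        have h8 := card_le_card h7
        omega)
    obtain ⟨φ, hφ, -⟩ := exists_isEmb_of_clique G (F := F) (T := C) (Q := Z)
      (fun u hu v hv huv => by
        by_contra h
        exact hZind u hu v hv ((SimpleGraph.compl_adj _ _ _).2 ⟨huv, h⟩)) (hCn.trans hZn)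
    exact ⟨φ, hφ⟩
  · obtain ⟨S, hSC, hScard, h1, h2, h3⟩ := exists_small_separator hne hmin hconn hsum
    obtain ⟨x, hinj, hmem, hbr⟩ := exists_listing_few_breaks hk hfree (univ \ (Z ∪ Q))
    refine exists_isEmb_of_listing hSC h1 h2 h3 hQ (s := s) (r := k - 2) ?_ ?_ hinj hmem hbr
      (by omega) (by omega) ?_
    · intro w hw h
      simp [h] at hw
    · intro w hw
      by_contra! h
      simp only [mem_sdiff, mem_union, not_or, hZ, mem_filter, not_and, mem_univ, true_and] at hw
      exact absurd h (hw.1 hw.2)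
    · have h4 := card_sdiff_of_subset (subset_univ (Z ∪ Q))
      have h5 := card_union_le Z Q
      rw [card_univ] at h4
      omega

lemma exists_isEmb_core_of_small_degree [Fintype W] [Nonempty W] {G : SimpleGraph V}
    {F : SimpleGraph W} {C : Finset V} {k l n : ℕ} (hk : 3 ≤ k) (hn : 12 * k ^ 2 * l ≤ n)
    (hfree : ¬ (SimpleGraph.cycleGraph k).IsContained Fᶜ) (hCn : #C ≤ n)
    (hmin : ∀ v ∈ C, 2 ≤ #(nbIn G v C))
    (hsum : ∑ x ∈ C, #(nbIn G x C) ≤ 2 * #C + 2 * l)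
    (hN : 2 * n + 23 * k ^ 2 ≤ Fintype.card W)
    (hdeg : ∀ w, #(nbIn Fᶜ w univ) ≤ (k - 2) * (16 * l + 5 * k)) :
    ∃ φ, IsEmb G F C φ := by
  classical
  obtain ⟨v, -, hv⟩ := exists_max_image (univ : Finset W) (fun w => #(nbIn Fᶜ w univ)) univ_nonempty
  set D := #(nbIn Fᶜ v univ) with hD
  obtain ⟨Q, -, hQ, hQcard⟩ := exists_clique_in_nbhd hk hfree (v := v) (A := nbIn Fᶜ v univ)
    fun a ha => (mem_nbIn.1 ha).2
  rw [← hD] at hQcard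
  have hDle : D ≤ (k - 2) * (16 * l + 5 * k) := hdeg v
  rcases Nat.eq_zero_or_pos D with hD0 | hDpos
  · obtain ⟨φ, hφ, -⟩ := exists_isEmb_of_clique G (F := F) (T := C) (Q := univ) (by
      intro u _ w _ huw
      by_contra h
      have h1 := hv u (mem_univ u)
      have h2 : w ∈ nbIn Fᶜ u univ := by simp [huw, h]
      have h3 := card_pos.2 ⟨w, h2⟩
      omega) (by rw [card_univ]; omega)
    exact ⟨φ, hφ⟩
  -- Chosen to balance two needs: the high-degree set has size at most `2l / (e + 1) ≤ D / (k - 2) ≤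
  -- #Q`, and the greedy cost is `(e + 2)D ≤ 2l(k - 2) + 2D`.
  set e := 2 * l * (k - 2) / D with he
  have he1 : 2 * l * (k - 2) ≤ D * (e + 1) := (Nat.lt_mul_div_succ _ hDpos).le
  have he2 : e * D ≤ 2 * l * (k - 2) := Nat.div_mul_le_self _ _
  set H := C.filter fun v => e + 3 ≤ #(nbIn G v C) with hH
  have hHcard : #H * (e + 1) ≤ 2 * l := by
    have h1 := sum_filter_add_sum_filter_not C (fun v => e + 3 ≤ #(nbIn G v C))
      (fun v => #(nbIn G v C))
    have h2 := card_filter_add_card_filter_not (s := C) (fun v => e + 3 ≤ #(nbIn G v C))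
    have h3 : #(C.filter fun v => ¬ e + 3 ≤ #(nbIn G v C)) • 2 ≤
        ∑ x ∈ C.filter (fun v => ¬ e + 3 ≤ #(nbIn G v C)), #(nbIn G x C) :=
      card_nsmul_le_sum _ _ _ fun x hx => hmin x (mem_filter.1 hx).1
    have h4 : #H • (e + 3) ≤ ∑ x ∈ H, #(nbIn G x C) :=
      card_nsmul_le_sum _ _ _ fun x hx => (mem_filter.1 hx).2
    simp only [smul_eq_mul] at h3 h4
    rw [← hH] at h1 h2
    nlinarith
  have hHQ : #H ≤ #Q := by
    rcases Nat.eq_zero_or_pos l with hl | hl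
    · subst hl
      have : #H = 0 := by
        by_contra h
        have := Nat.mul_pos (Nat.pos_of_ne_zero h) (Nat.add_one_pos e)
        omega
      omega
    · have h1 : 2 * l * (#H * (k - 2)) ≤ 2 * l * (#Q * (k - 2)) := by
        calc 2 * l * (#H * (k - 2)) = #H * (2 * l * (k - 2)) := by ring
          _ ≤ #H * (D * (e + 1)) := Nat.mul_le_mul_left _ he1
          _ = #H * (e + 1) * D := by ring
          _ ≤ 2 * l * D := Nat.mul_le_mul_right _ hHcard
          _ ≤ 2 * l * ((k - 2) * #Q) := Nat.mul_le_mul_left _ hQcard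
          _ = 2 * l * (#Q * (k - 2)) := by ring
      exact Nat.le_of_mul_le_mul_right (Nat.le_of_mul_le_mul_left h1 (by omega)) (by omega)
  obtain ⟨φ₀, hφ₀, -⟩ := exists_isEmb_of_clique G hQ hHQ
  obtain ⟨φ, hφ, -⟩ := exists_isEmb_greedy (T₀ := H) (T := C) (filter_subset _ _) hφ₀
    (P := fun _ => True) (fun _ _ => trivial) (A := univ) (d := e + 2) (D := D)
    (fun x _ => hv x (mem_univ x)) (by
      intro S h1 h2 h3
      obtain ⟨u, hu, huH⟩ := exists_of_ssubset (Finset.ssubset_iff_subset_ne.2 ⟨h1, Ne.symm h3⟩)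
      refine ⟨u, hu, huH, ?_⟩
      have h4 := card_le_card (nbIn_mono G u h2)
      simp only [hH, mem_filter, not_and, not_le] at huH
      have := huH (h2 hu)
      omega) (fun _ _ _ _ _ _ _ _ => trivial) (by
      rw [card_univ]
      obtain ⟨j, rfl⟩ : ∃ j, k = j + 3 := ⟨k - 3, by omega⟩
      have e1 : j + 3 - 2 = j + 1 := by omega
      rw [e1] at hDle he2
      nlinarith [Nat.zero_le (j * l), Nat.zero_le (j * j * l)])
  exact ⟨φ, hφ⟩

/-! ### Reduction to the core, and the case of a large co-degree. -/

/-- Leaves can be added greedily, so it is enough to embed the parts of minimum degree two. -/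
lemma exists_isEmb_of_core [Fintype W] [Nonempty W] {G : SimpleGraph V} {F : SimpleGraph W} {D : ℕ}
    (hdeg : ∀ w, #(nbIn Fᶜ w univ) ≤ D) {n : ℕ} (hN : n + D ≤ Fintype.card W)
    (hcore : ∀ C : Finset V, C.Nonempty → #C ≤ n → CutConnected G C →
      (∀ v ∈ C, 2 ≤ #(nbIn G v C)) → ∃ φ, IsEmb G F C φ) :
    ∀ C : Finset V, #C ≤ n → CutConnected G C → ∃ φ, IsEmb G F C φ := by
  classical
  intro C
  induction C using Finset.strongInduction with
  | H C ih =>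
    intro hCn hconn
    rcases C.eq_empty_or_nonempty with rfl | hne
    · exact ⟨fun _ => Classical.arbitrary W, by simp [IsEmb]⟩
    by_cases hmin : ∀ v ∈ C, 2 ≤ #(nbIn G v C)
    · exact hcore C hne hCn hconn hmin
    push Not at hmin
    obtain ⟨v, hv, hv1⟩ := hmin
    have hcard := card_erase_add_one hv
    obtain ⟨φ, hφ⟩ := ih _ (erase_ssubset hv) (by omega) (hconn.erase_leaf hv (by omega))
    obtain ⟨w, -, hw1, hw2⟩ := exists_free_vertex (G := G) (F := F) (φ := φ) (v := v)
      (S := C.erase v) (A := univ) (d := 1) (D := D)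
      ((card_le_card (nbIn_mono G v (erase_subset v C))).trans (by omega))
      (fun u _ => hdeg _) (by rw [card_univ]; omega)
    have := hφ.insert (notMem_erase v C) hw1 hw2
    rw [insert_erase hv] at this
    exact ⟨_, this⟩

/-- Many vertices of degree at most two are pairwise nonadjacent. -/
lemma exists_independent_low_degree [Fintype V] {G : SimpleGraph V} {l : ℕ}
    (hmin : ∀ v, 1 ≤ #(nbIn G v univ))
    (hsum : ∑ x : V, #(nbIn G x univ) ≤ 2 * Fintype.card V + 2 * l) :
    ∃ J : Finset V, (∀ u ∈ J, ∀ v ∈ J, ¬ G.Adj u v) ∧ (∀ u ∈ J, #(nbIn G u univ) ≤ 2) ∧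
      Fintype.card V ≤ 6 * #J + 2 * l := by
  classical
  set L : Finset V := univ.filter fun v => #(nbIn G v univ) ≤ 2 with hL
  obtain ⟨J, hJL, hJ, hcard⟩ := DegenerateOn.exists_independent (H := G) (d := 2) L (by
    intro T hT ⟨v, hv⟩
    exact ⟨v, hv, (card_le_card (nbIn_mono G v (subset_univ T))).trans (mem_filter.1 (hT hv)).2⟩)
  refine ⟨J, hJ, fun u hu => (mem_filter.1 (hJL hu)).2, ?_⟩
  have h1 := sum_filter_add_sum_filter_not univ (fun v => #(nbIn G v univ) ≤ 2)
    (fun v => #(nbIn G v univ))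
  have h2 := card_filter_add_card_filter_not (s := (univ : Finset V))
    (fun v => #(nbIn G v univ) ≤ 2)
  have h3 : #(univ.filter fun v => ¬ #(nbIn G v univ) ≤ 2) • 3 ≤
      ∑ x ∈ univ.filter (fun v => ¬ #(nbIn G v univ) ≤ 2), #(nbIn G x univ) :=
    card_nsmul_le_sum _ _ _ fun x hx => by
      have := (mem_filter.1 hx).2
      omega
  have h4 : #L • 1 ≤ ∑ x ∈ L, #(nbIn G x univ) := card_nsmul_le_sum _ _ _ fun x _ => hmin x
  simp only [smul_eq_mul] at h3 h4
  rw [card_univ] at h2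
  rw [← hL] at h1 h2
  omega

/-- If all degrees in `T` exceed `d`, then `#T ≥ d + 2`, while the excess over degree two totals at
most `2l`; so `(d - 1)(d + 2) ≤ 2l`. -/
lemma degenerateOn_of_sum_le [Fintype V] {G : SimpleGraph V} {l d : ℕ}
    (hsum : ∀ S : Finset V, S.Nonempty → ∑ x ∈ S, #(nbIn G x S) ≤ 2 * #S + 2 * l)
    (hd : 2 * l < (d - 1) * (d + 2)) : DegenerateOn G univ d := by
  intro T _ hne
  by_contra! hcon
  obtain ⟨v, hv⟩ := hne
  have h1 := hsum T ⟨v, hv⟩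
  have h2 : #T • (d + 1) ≤ ∑ x ∈ T, #(nbIn G x T) := card_nsmul_le_sum _ _ _ fun x hx => hcon x hx
  have h3 : d + 2 ≤ #T := by
    have h4 : nbIn G v T ⊂ T :=
      (ssubset_iff_of_subset (nbIn_subset G v T)).2 ⟨v, hv, by simp⟩
    have := card_lt_card h4
    have := hcon v hv
    omega
  rw [smul_eq_mul] at h2
  rcases d with _ | d
  · simp at hd
  · simp only [Nat.add_sub_cancel] at hd
    nlinarith

/-- If some vertex has a large neighbourhood in `Fᶜ`, then `G` embeds into that neighbourhood. -/
lemma exists_isEmb_of_large_nbhd [Fintype V] [Fintype W] [Nonempty W] {G : SimpleGraph V}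
    {F : SimpleGraph W} {k l n : ℕ} (hk : 3 ≤ k) (hn : 12 * k ^ 2 * l ≤ n)
    (hfree : ¬ (SimpleGraph.cycleGraph k).IsContained Fᶜ) (hV : Fintype.card V = n)
    (hmin : ∀ v, 1 ≤ #(nbIn G v univ))
    (hsum : ∀ S : Finset V, S.Nonempty → ∑ x ∈ S, #(nbIn G x S) ≤ 2 * #S + 2 * l)
    (hne : Nonempty V) {v : W} (hv : n + 23 * k ^ 2 ≤ #(nbIn Fᶜ v univ)) :
    ∃ φ, IsEmb G F univ φ := by
  classical
  obtain ⟨A, hA, hAcard⟩ := exists_subset_card_eq hv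
  have hAdeg := degenerateOn_of_cycle_free hk hfree (v := v) (A := A)
    fun a ha => (mem_nbIn.1 (hA ha)).2
  have hAsum := hAdeg.sum_nbIn_le
  set Bad := A.filter fun a => 2 * k ^ 2 < #(nbIn Fᶜ a A) with hBad
  have hBadcard : #Bad * k ^ 2 ≤ (k - 3) * (n + 23 * k ^ 2) := by
    have h1 : #Bad • (2 * k ^ 2) ≤ ∑ x ∈ Bad, #(nbIn Fᶜ x A) :=
      card_nsmul_le_sum _ _ _ fun x hx => (mem_filter.1 hx).2.le
    have h2 : ∑ x ∈ Bad, #(nbIn Fᶜ x A) ≤ ∑ x ∈ A, #(nbIn Fᶜ x A) :=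
      sum_le_sum_of_subset (filter_subset _ _)
    rw [smul_eq_mul] at h1
    rw [hAcard] at hAsum
    nlinarith
  have hBad12 : 12 * #Bad ≤ n + 23 * k ^ 2 := by
    obtain ⟨j, rfl⟩ : ∃ j, k = j + 3 := ⟨k - 3, by omega⟩
    rw [Nat.add_sub_cancel] at hBadcard
    -- By AM-GM, `(k - 3) / k² ≤ 1 / 12`, so at most a twelfth of `A` is bad.
    have h12 : 12 * j ≤ (j + 3) ^ 2 := by nlinarith [sq_nonneg ((j : ℤ) - 3), two_mul_le_add_sq j 3]
    have : (j + 3) ^ 2 * (12 * #Bad) ≤ (j + 3) ^ 2 * (n + 23 * (j + 3) ^ 2) := by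
      nlinarith [Nat.mul_le_mul_right (n + 23 * (j + 3) ^ 2) h12]
    exact Nat.le_of_mul_le_mul_left this (by positivity)
  obtain ⟨J, hJ, hJ2, hJcard⟩ := exists_independent_low_degree hmin (by
    simpa using hsum univ univ_nonempty)
  have hdegen := degenerateOn_of_sum_le (d := 3 + l / 3) hsum (by
    obtain ⟨t, ht⟩ : ∃ t, t = l / 3 := ⟨_, rfl⟩
    rw [← ht]
    have : l ≤ 3 * t + 2 := by omega
    have e : 3 + t - 1 = t + 2 := by omega
    rw [e]
    nlinarith)
  have hTcard : #(univ \ J) = n - #J := by rw [card_sdiff_of_subset (subset_univ J), card_univ, hV]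
  have hJn : #J ≤ n := hV ▸ card_le_univ J
  have hWcard : #(A \ Bad) = n + 23 * k ^ 2 - #Bad := by
    rw [card_sdiff_of_subset (filter_subset _ _), hAcard]
  have hgood : ∀ x ∈ A \ Bad, #(nbIn Fᶜ x A) ≤ 2 * k ^ 2 := fun x hx => by
    rw [mem_sdiff] at hx
    by_contra! h
    exact hx.2 (mem_filter.2 ⟨hx.1, h⟩)
  obtain ⟨φ₀, hφ₀, -, hφ₀A⟩ := exists_isEmb_greedy (G := G) (F := F) (T₀ := ∅) (T := univ \ J)
    (empty_subset _) (φ₀ := fun _ => v) (by simp [IsEmb]) (P := fun x => x ∈ A \ Bad) (by simp)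
    (A := A \ Bad) (d := 3 + l / 3) (D := 2 * k ^ 2)
    (fun x hx => (card_le_card (nbIn_mono _ _ sdiff_subset)).trans (hgood x hx)) (by
      intro S _ _ hS
      obtain ⟨u, hu, hud⟩ := hdegen S (subset_univ S) (nonempty_iff_ne_empty.2 hS)
      exact ⟨u, hu, by simp, hud⟩) (fun _ _ _ _ _ _ x hx => hx) (by
      -- Postponing `J` saves about `n / 6` vertices and avoiding `Bad` costs about `n / 12`; the
      -- difference, at least `l * k ^ 2`, pays for the degeneracy term.
      have h1 : 3 * (l / 3) ≤ l := Nat.mul_div_le l 3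
      have h2 : 3 * (l / 3 * k ^ 2) ≤ l * k ^ 2 := by nlinarith
      have h3 : 12 * (l * k ^ 2) ≤ n := by nlinarith
      have h4 : 9 * l ≤ l * k ^ 2 := by nlinarith [Nat.mul_le_mul hk hk]
      have h5 : (3 + l / 3) * (2 * k ^ 2) = 6 * k ^ 2 + 2 * (l / 3 * k ^ 2) := by ring
      rw [hTcard, hWcard, h5]
      omega)
  obtain ⟨φ, hφ, -⟩ := exists_isEmb_greedy (G := G) (F := F) (T₀ := univ \ J) (T := univ)
    (subset_univ _) hφ₀ (P := fun x => x ∈ A \ Bad) (fun u hu => hφ₀A u hu (by simp))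
    (A := A) (d := 2) (D := 2 * k ^ 2) hgood (by
      intro S h1 _ h2
      obtain ⟨u, hu, huJ⟩ := exists_of_ssubset (Finset.ssubset_iff_subset_ne.2 ⟨h1, Ne.symm h2⟩)
      refine ⟨u, hu, huJ, (card_le_card (nbIn_mono G u (subset_univ S))).trans (hJ2 u ?_)⟩
      simpa using huJ) (by
      intro u _ hu w hw hwJ
      exact absurd (mem_nbIn.1 hw).2 (hJ u (by simpa using hu) w (by simpa using hwJ))) (by
      rw [card_univ, hV, hAcard]
      omega)
  exact ⟨φ, hφ⟩

/-! ### Assembling the cases. -/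

theorem isContained_or_cycle_isContained_compl [Fintype V] [Fintype W] {G : SimpleGraph V}
    {k l n : ℕ} (hk : 3 ≤ k) (hkn : 12 * k ≤ n) (hn : 12 * k ^ 2 * l ≤ n)
    (hV : Fintype.card V = n) (hG : G.Connected) (hedges : G.edgeSet.ncard ≤ n + l)
    (F : SimpleGraph W) (hW : Fintype.card W = 2 * n + 23 * k ^ 2) :
    G.IsContained F ∨ (SimpleGraph.cycleGraph k).IsContained Fᶜ := by
  classical
  by_contra hcon
  obtain ⟨hGF, hfree⟩ := not_or.1 hcon
  suffices h : ∃ φ, IsEmb G F univ φ from hGF h.choose_spec.isContained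
  have : Nonempty W := Fintype.card_pos_iff.1 (by omega)
  have : Nonempty V := hG.nonempty
  have hconn := cutConnected_univ hG
  have hsum : ∀ S : Finset V, S.Nonempty → ∑ x ∈ S, #(nbIn G x S) ≤ 2 * #S + 2 * l := by
    intro S hS
    have h1 := hconn.sum_nbIn_le S (subset_univ S) hS
    rw [sum_nbIn_univ, card_univ, hV] at h1
    omega
  by_cases hbig : ∃ v, n + 23 * k ^ 2 ≤ #(nbIn Fᶜ v univ)
  · obtain ⟨v, hv⟩ := hbig
    refine exists_isEmb_of_large_nbhd hk hn hfree hV (fun v => ?_) hsum ‹_› hv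
    obtain ⟨u, hu, w, -, -, huw⟩ := hconn {v} (Finset.ssubset_univ_iff.2 fun h => by
      have := congrArg card h
      rw [card_singleton, card_univ, hV] at this
      omega) (singleton_nonempty v)
    rw [mem_singleton] at hu
    subst hu
    exact card_pos.2 ⟨w, by simp [huw]⟩
  push Not at hbig
  refine exists_isEmb_of_core (n := n) (D := n + 23 * k ^ 2) (fun w => (hbig w).le) (by omega)
    (fun C hne hCn hC hmin => ?_) univ (by rw [card_univ, hV]) hconn
  by_cases hdeg : ∀ w, #(nbIn Fᶜ w univ) ≤ (k - 2) * (16 * l + 5 * k)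
  · exact exists_isEmb_core_of_small_degree hk hn hfree hCn hmin (hsum C hne) hW.ge hdeg
  · push Not at hdeg
    obtain ⟨w, hw⟩ := hdeg
    obtain ⟨Q, -, hQ, hQcard⟩ := exists_clique_in_nbhd hk hfree (v := w) (A := nbIn Fᶜ w univ)
      fun a ha => (mem_nbIn.1 ha).2
    refine exists_isEmb_core_of_clique hk (by omega) hfree hCn hne hmin hC (hsum C hne)
      (by rw [hW]; nlinarith) hQ ?_
    exact Nat.le_of_mul_le_mul_left (hw.le.trans hQcard) (by omega)

end SparseRamsey

theorem mainTheorem7 (k n : ℕ) (hk : 3 ≤ k) (hn : 12 * k ≤ n)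
    {V : Type*} [Fintype V] (hV : Fintype.card V = n)
    (G : SimpleGraph V) (hG : G.Connected)
    (hedges : (G.edgeSet.ncard : ℝ) ≤ (1 + 1 / (12 * (k : ℝ) ^ 2)) * (n : ℝ)) :
    -- the minimum that defines `r(G, C_k)` is attained, so that the bound concerns a genuine value
    IsLeast {N : ℕ | 0 < N ∧ RamseyArrows G (SimpleGraph.cycleGraph k) N}
        (ramseyNumber G (SimpleGraph.cycleGraph k)) ∧
      ramseyNumber G (SimpleGraph.cycleGraph k) ≤ 2 * n + 23 * k ^ 2 := by
  have hk0 : 0 < 12 * k ^ 2 := by positivity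
  -- The number of edges is an integer, so the real bound on the excess can be replaced by its
  -- floor, which serves as `l`.
  have hedges' : G.edgeSet.ncard ≤ n + n / (12 * k ^ 2) := by
    by_cases h : G.edgeSet.ncard ≤ n
    · exact h.trans (Nat.le_add_right _ _)
    push Not at h
    obtain ⟨m, hm⟩ := Nat.exists_eq_add_of_lt h
    suffices hle : (m + 1) * (12 * k ^ 2) ≤ n by
      have := (Nat.le_div_iff_mul_le hk0).2 hle
      omega
    have hk0' : (0 : ℝ) < 12 * (k : ℝ) ^ 2 := by exact_mod_cast hk0
    rw [hm] at hedges
    push_cast at hedges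
    have h1 : ((m : ℝ) + 1) ≤ n / (12 * (k : ℝ) ^ 2) := by
      rw [div_eq_mul_one_div]
      linarith
    rw [le_div_iff₀ hk0'] at h1
    exact_mod_cast h1
  have hmem : 2 * n + 23 * k ^ 2 ∈
      {N : ℕ | 0 < N ∧ RamseyArrows G (SimpleGraph.cycleGraph k) N} :=
    ⟨by omega, fun F => SparseRamsey.isContained_or_cycle_isContained_compl hk hn
      (Nat.mul_div_le n _) hV hG hedges' F (Fintype.card_fin _)⟩
  exact ⟨⟨Nat.sInf_mem ⟨_, hmem⟩, fun _ h => Nat.sInf_le h⟩, Nat.sInf_le hmem⟩
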